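/- Let $n\ge 1$ and let $\langle f\rangle=\int_{\mathbb R^n} f\,dx$ (Lebesgue measure). Let $\Gamma\subseteq[0,\infty)$ be a set of exponents containing at least one positive number (for instance $\Gamma=[0,\infty)$ or $\Gamma=\{\gamma\}$ with $\gamma>0$), and let $\mathcal P$ be the set of probability densities $p$ on $\mathbb R^n$ with $\langle p^{1+\gamma}\rangle<\infty$ for all $\gamma\in\Gamma$. Write $\|p\|_{1+\gamma}=\langle p^{1+\gamma}\rangle^{1/(1+\gamma)}$ and $\log 0=-\infty$. Two functionals $d,\tilde d:\mathcal P\times\mathcal P\to[-\infty,\infty]$ are called equivalent if $\tilde d(q,p)=\xi(d(q,p))$ for all $q,p\in\mathcal P$, where $\xi$ is strictly increasing on the set of values of $d$. A divergence $D(q,p)=d(q,p)-d(q,q)$ is considered through its cross-entropy $d$, up to equivalence. For $\gamma\in\Gamma$ consider the following cross-entropies. * NB-DPD (norm-based Bregman density power divergence). Let $\phi_\gamma:[0,\infty)\to\mathbb R$ $(\gamma\ge0)$ be strictly increasing, convex, and differentiable on $(0,\infty)$, with $\gamma\mapsto\phi_\gamma(1)$ differentiable at $0$ (from the right). Put $$d^{\rm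 NB}_{\phi,\gamma}(q,p)=-\frac{\phi_\gamma(\|p\|_{1+\gamma})-\phi_0(1)}{\gamma}-\frac{\phi_\gamma'(\|p\|_{1+\gamma})\,(\langle qp^\gamma\rangle-\langle p^{1+\gamma}\rangle)}{\gamma\|p\|_{1+\gamma}^{\gamma}}\quad(\gamma>0),$$ and $d^{\rm NB}_{\phi,0}(q,p)=-\phi_0'(1)\langle q\log p\rangle-\partial_\gamma\phi_\gamma(1)|_{\gamma=0}$. * FDPD (functional density power divergence). Let $v:[0,\infty)\to[-\infty,\infty]$ be such that $w(x)=v(e^x)$ is strictly increasing and convex on $\mathbb R\cup\{-\infty\}$. Put $$d^{\rm FDP}_{v,\gamma}(q,p)=-\frac{1+\gamma}{\gamma}v(\langle qp^\gamma\rangle)+\frac1\gamma v(1)+v(\langle p^{1+\gamma}\rangle)\quad(\gamma>0),$$ and $d^{\rm FDP}_{v,0}(q,p)=-v'(1)\langle q\log p\rangle$ (for $v$ differentiable at $1$). * BDPD (bridge density power divergence). For $\lambda_1,\lambda_2\ge0$, not both $0$, put $$d^{\rm BDP}_{\lambda,\gamma}(q,p)=-\frac{1+\gamma}{\lambda_2\gamma}\log(\lambda_1+\lambda_2\langle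 qp^\gamma\rangle)+\frac1{\lambda_2\gamma}\log(\lambda_1+\lambda_2)+\frac1{\lambda_2}\log(\lambda_1+\lambda_2\langle p^{1+\gamma}\rangle)\quad(\gamma>0,\ \lambda_2>0),$$ with, for $\gamma>0$ and $\lambda_2=0$, the limit $\frac1{\lambda_1}\bigl(-\frac{1+\gamma}{\gamma}\langle qp^\gamma\rangle+\frac1\gamma+\langle p^{1+\gamma}\rangle\bigr)$ (a multiple of the density power cross-entropy), and, for $\gamma=0$, $-\frac1{\lambda_1+\lambda_2}\langle q\log p\rangle$. Then the intersection of the NB-DPD class and the FDPD class is exactly the BDPD class: a functional $d:\mathcal P\times\mathcal P\to[-\infty,\infty]$ is equivalent both to some $d^{\rm NB}_{\phi,\gamma}$ with $\gamma\in\Gamma$ and to some $d^{\rm FDP}_{v,\gamma'}$ with $\gamma'\in\Gamma$ if and only if it is equivalent to some $d^{\rm BDP}_{\lambda,\gamma}$ with $\gamma\in\Gamma$. Moreover, for $\gamma\in\Gamma$ with $\gamma>0$ and $v$ as above, $d^{\rm FDP}_{v,\gamma}$ is equivalent to some $d^{\rm NB}_{\phi,\gamma'}$ with $\gamma'\in\Gamma$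 if and only if, on $[0,\infty)$, either $v(z)=az+b$ with $a>0$, $b\in\mathbb R$, or $v(z)=a\log(\lambda_1+\lambda_2z)+b$ with $a>0$, $b\in\mathbb R$, $\lambda_1\ge0$, $\lambda_2>0$. -/

import Mathlib

open MeasureTheory Set
open scoped ENNReal

noncomputable section

namespace PowerDivergence

/-- Probability densities `p` with respect to Lebesgue measure on `ℝⁿ` for which
`⟨p ^ (1 + γ)⟩` is finite for every exponent `γ ∈ Γ`. -/
def densities (n : ℕ) (Γ : Set ℝ) : Set (EuclideanSpace ℝ (Fin n) → ℝ) :=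
  {p | Measurable p ∧ (∀ x, 0 ≤ p x) ∧ Integrable p ∧ ∫ x, p x = 1 ∧
    ∀ γ ∈ Γ, Integrable fun x => p x ^ (1 + γ)}

/-- Functionals `d (q, p)` on pairs of densities; the value `+∞` may occur. -/
abbrev Functional (n : ℕ) (Γ : Set ℝ) : Type :=
  densities n Γ → densities n Γ → EReal

/-- Equivalence of cross-entropies: `d'` is a strictly increasing function of `d`
(strictly increasing on the set of values that `d` takes). -/
def Equivalent {n : ℕ} {Γ : Set ℝ} (d d' : Functional n Γ) : Prop :=
  ∃ ξ : EReal → EReal, StrictMonoOn ξ {t | ∃ q p, d q p = t} ∧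
    ∀ q p, d' q p = ξ (d q p)

section functionals

variable {n : ℕ}

/-- `⟨q p ^ γ⟩`. -/
def cross (γ : ℝ) (q p : EuclideanSpace ℝ (Fin n) → ℝ) : ℝ := ∫ x, q x * p x ^ γ

/-- `⟨p ^ (1 + γ)⟩`. -/
def power (γ : ℝ) (p : EuclideanSpace ℝ (Fin n) → ℝ) : ℝ := ∫ x, p x ^ (1 + γ)

/-- The `L_{1+γ}`-norm of a nonnegative function. -/
def powerNorm (γ : ℝ) (p : EuclideanSpace ℝ (Fin n) → ℝ) : ℝ := power γ p ^ (1 / (1 + γ))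

/-- The Shannon cross-entropy `-⟨q log p⟩`, with `log 0 = -∞` and `0 · (±∞) = 0`: the integral of
the negative part of `q log p` minus the integral of its positive part. -/
def shannon (q p : EuclideanSpace ℝ (Fin n) → ℝ) : EReal :=
  ((∫⁻ x, ENNReal.ofReal (q x) *
      (-ENNReal.log (ENNReal.ofReal (p x))).toENNReal : ℝ≥0∞) : EReal) -
  ((∫⁻ x, ENNReal.ofReal (q x) *
      (ENNReal.log (ENNReal.ofReal (p x))).toENNReal : ℝ≥0∞) : EReal)

/-- The norm-based Bregman density power cross-entropy of the family `φ γ`, `γ ≥ 0`. -/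
def nbCE (φ : ℝ → ℝ → ℝ) (γ : ℝ) (q p : EuclideanSpace ℝ (Fin n) → ℝ) : EReal :=
  if γ = 0 then
    ((deriv (φ 0) 1 : ℝ) : EReal) * shannon q p -
      ((derivWithin (fun g => φ g 1) (Ici 0) 0 : ℝ) : EReal)
  else
    ((-((φ γ (powerNorm γ p) - φ 0 1) / γ) -
      deriv (φ γ) (powerNorm γ p) * (cross γ q p - power γ p) /
        (γ * powerNorm γ p ^ γ) : ℝ) : EReal)

/-- The functional density power cross-entropy of `v`. -/
def fdpCE (v : ℝ → EReal) (γ : ℝ) (q p : EuclideanSpace ℝ (Fin n) → ℝ) : EReal :=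
  if γ = 0 then
    ((deriv (fun z => (v z).toReal) 1 : ℝ) : EReal) * shannon q p
  else
    -((((1 + γ) / γ : ℝ) : EReal) * v (cross γ q p)) +
      ((1 / γ : ℝ) : EReal) * v 1 + v (power γ p)

/-- The density power cross-entropy. -/
def dpCE (γ : ℝ) (q p : EuclideanSpace ℝ (Fin n) → ℝ) : ℝ :=
  -((1 + γ) / γ * cross γ q p) + 1 / γ + power γ p

/-- The extended logarithm of a nonnegative real, `log 0 = -∞`. -/
def elog (z : ℝ) : EReal := ENNReal.log (ENNReal.ofReal z)

/-- The (log-type) bridge density power cross-entropy with parameters `l₁, l₂ ≥ 0`, not both zero.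
For `l₂ = 0` it is its limit as `l₂ → 0`, namely `1 / l₁` times the density power cross-entropy;
for `γ = 0` it is its limit as `γ → 0`, a multiple of the Shannon cross-entropy. -/
def bdpCE (l₁ l₂ γ : ℝ) (q p : EuclideanSpace ℝ (Fin n) → ℝ) : EReal :=
  if γ = 0 then ((1 / (l₁ + l₂) : ℝ) : EReal) * shannon q p
  else if l₂ = 0 then ((1 / l₁ * dpCE γ q p : ℝ) : EReal)
  else
    -((((1 + γ) / (l₂ * γ) : ℝ) : EReal) * elog (l₁ + l₂ * cross γ q p)) +
      ((1 / (l₂ * γ) : ℝ) : EReal) * elog (l₁ + l₂) +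
      ((1 / l₂ : ℝ) : EReal) * elog (l₁ + l₂ * power γ p)

end functionals

/-- The families `φ γ : [0, ∞) → ℝ`, `γ ≥ 0`, that generate norm-based Bregman density power
divergences: strictly increasing, convex, and with the derivatives that the definition uses. -/
structure IsNBGenerator (φ : ℝ → ℝ → ℝ) : Prop where
  strictMono : ∀ γ, 0 ≤ γ → StrictMonoOn (φ γ) (Ici 0)
  convex : ∀ γ, 0 ≤ γ → ConvexOn ℝ (Ici 0) (φ γ)
  differentiable : ∀ γ, 0 ≤ γ → ∀ z, 0 < z → DifferentiableAt ℝ (φ γ) z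
  differentiable_param : DifferentiableWithinAt ℝ (fun γ => φ γ 1) (Ici 0) 0

/-- The functions `v : [0, ∞) → [-∞, ∞]` that generate functional density power divergences:
`w x = v (exp x)` is strictly increasing on `ℝ ∪ {-∞}` and convex. Strict monotonicity makes `v`
finite on `(0, ∞)`, and makes the convexity inequality hold whenever one point is `-∞`. -/
structure IsFDPGenerator (v : ℝ → EReal) : Prop where
  strictMono : StrictMonoOn v (Ici 0)
  convex : ∀ x y s t : ℝ, 0 ≤ s → 0 ≤ t → s + t = 1 →
    v (Real.exp (s * x + t * y)) ≤ (s : EReal) * v (Real.exp x) + (t : EReal) * v (Real.exp y)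

/-- All functionals equivalent to a norm-based Bregman density power cross-entropy with exponent
in `Γ`. -/
def nbClass (n : ℕ) (Γ : Set ℝ) : Set (Functional n Γ) :=
  {d | ∃ γ ∈ Γ, ∃ φ, IsNBGenerator φ ∧ Equivalent (fun q p => nbCE φ γ q.1 p.1) d}

/-- All functionals equivalent to a functional density power cross-entropy with exponent in `Γ`
(for `γ = 0` the definition presupposes that `v` is differentiable at `1`). -/
def fdpClass (n : ℕ) (Γ : Set ℝ) : Set (Functional n Γ) :=
  {d | ∃ γ ∈ Γ, ∃ v, IsFDPGenerator v ∧
    (γ = 0 → DifferentiableAt ℝ (fun z => (v z).toReal) 1) ∧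
    Equivalent (fun q p => fdpCE v γ q.1 p.1) d}

/-- All functionals equivalent to a bridge density power cross-entropy with exponent in `Γ`. -/
def bdpClass (n : ℕ) (Γ : Set ℝ) : Set (Functional n Γ) :=
  {d | ∃ γ ∈ Γ, ∃ l₁ l₂ : ℝ, 0 ≤ l₁ ∧ 0 ≤ l₂ ∧ 0 < l₁ + l₂ ∧
    Equivalent (fun q p => bdpCE l₁ l₂ γ q.1 p.1) d}

end PowerDivergence

end

/-!
Two functionals are equivalent exactly when they order the pairs `(q, p)` in the same way. Suppose a
norm-based and a functional cross-entropy are equivalent. Their exponents coincide, because for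
different exponents there are step densities `q, q', p` whose cross terms with `p` agree for one
exponent and differ for the other. For exponent `0` a norm-based cross-entropy is an increasing
affine function of the Shannon cross-entropy. For a common exponent `γ > 0` every pair `x ≥ 0`,
`y > 0` is realised as `x = ⟨q p ^ γ⟩`, `y = ⟨p ^ (1 + γ)⟩`, so that `-((1 + γ) / γ) v x + v y`
orders these pairs in the same way as a function that is affine in `x` for fixed `y`. Raising `y`
compensates for an increase of `v x` by `c`, hence `x` is moved by an affine map depending on `c`
only: `v (A c * x + B c) = v x + c`. Here `log (A c)` is additive in `c`, and `v` is affine if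
`A = 1` and a logarithm of an affine function otherwise, first on `(0, ∞)` and then also at `0`,
where a jump would contradict the affine order. Conversely, these `v` and the norm-based generators
`z ↦ z ^ (1 + γ)` and `z ↦ (l₁ + l₂ * z ^ (1 + γ)) ^ (1 / (1 + γ))` give the bridge cross-entropies
up to equivalence.
-/

noncomputable section

namespace PowerDivergence

/-! ### Equivalence as agreement of orders -/

section Equivalence

variable {n : ℕ} {Γ : Set ℝ} {d d' d'' : Functional n Γ}

theorem Equivalent.lt_iff_lt (h : Equivalent d d') (q p q' p' : densities n Γ) :
    d q p < d q' p' ↔ d' q p < d' q' p' := by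
  obtain ⟨ξ, hξ, hd⟩ := h
  rw [hd, hd, hξ.lt_iff_lt ⟨q, p, rfl⟩ ⟨q', p', rfl⟩]

theorem equivalent_of_lt_iff_lt (h : ∀ q p q' p', d q p < d q' p' ↔ d' q p < d' q' p') :
    Equivalent d d' := by
  have hfactors : (Function.uncurry d').FactorsThrough (Function.uncurry d) := fun x y hxy =>
    le_antisymm (not_lt.1 fun hlt => ((h _ _ _ _).2 hlt).ne hxy.symm)
      (not_lt.1 fun hlt => ((h _ _ _ _).2 hlt).ne hxy)
  have hd (q p) : d' q p = Function.extend (Function.uncurry d) (Function.uncurry d') 0 (d q p) :=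
    (hfactors.extend_apply 0 (q, p)).symm
  refine ⟨_, ?_, hd⟩
  rintro _ ⟨q, p, rfl⟩ _ ⟨q', p', rfl⟩ hlt
  simpa only [← hd] using (h q p q' p').1 hlt

theorem Equivalent.symm (h : Equivalent d d') : Equivalent d' d :=
  equivalent_of_lt_iff_lt fun q p q' p' => (h.lt_iff_lt q p q' p').symm

theorem Equivalent.trans (h : Equivalent d d') (h' : Equivalent d' d'') : Equivalent d d'' :=
  equivalent_of_lt_iff_lt fun q p q' p' => (h.lt_iff_lt q p q' p').trans (h'.lt_iff_lt q p q' p')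

theorem Equivalent.eq_iff_eq (h : Equivalent d d') (q p q' p' : densities n Γ) :
    d q p = d q' p' ↔ d' q p = d' q' p' := by
  simp only [le_antisymm_iff, ← not_lt, h.lt_iff_lt]

theorem equivalent_of_strictMono {f : EReal → EReal} (hf : StrictMono f)
    (h : ∀ q p, d' q p = f (d q p)) : Equivalent d d' :=
  ⟨f, hf.strictMonoOn _, h⟩

end Equivalence

/-! ### Affine maps and the logarithm on the extended reals -/

section ExtendedReals

theorem strictMono_coe_mul {a : ℝ} (ha : 0 < a) : StrictMono fun x : EReal => (a : EReal) * x := by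
  have hmono {b : ℝ} (hb : 0 < b) : Monotone fun x : EReal => (b : EReal) * x :=
    fun _ _ hxy => mul_le_mul_of_nonneg_left hxy (EReal.coe_nonneg.2 hb.le)
  have hinv : Function.LeftInverse (fun x : EReal => ((a⁻¹ : ℝ) : EReal) * x) fun x => a * x := by
    intro x
    beta_reduce
    rw [← mul_assoc, ← EReal.coe_mul, inv_mul_cancel₀ ha.ne', EReal.coe_one, one_mul]
  exact (hmono ha).strictMono_of_injective hinv.injective

theorem strictMono_coe_mul_add_coe {a : ℝ} (ha : 0 < a) (b : ℝ) :
    StrictMono fun x : EReal => (a : EReal) * x + b :=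
  fun _ _ hxy => EReal.add_lt_add_right_coe (strictMono_coe_mul ha hxy) b

theorem strictAnti_neg_coe_mul_add_coe {a : ℝ} (ha : 0 < a) (b : ℝ) :
    StrictAnti fun x : EReal => -((a : EReal) * x) + b :=
  fun _ _ hxy => EReal.add_lt_add_right_coe (EReal.neg_strictAnti (strictMono_coe_mul ha hxy)) b

theorem continuous_coe_mul_add_coe (a b : ℝ) : Continuous fun x : EReal => (a : EReal) * x + b :=
  continuous_iff_continuousAt.2 fun x =>
    have hmul : ContinuousAt (fun y : EReal => (a : EReal) * y) x :=
      EReal.Tendsto.const_mul Filter.tendsto_id (.inl (EReal.coe_ne_bot a))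
        (.inl (EReal.coe_ne_top a))
    ContinuousAt.comp (g := fun y : EReal × EReal => y.1 + y.2)
      (EReal.continuousAt_add (.inr (EReal.coe_ne_bot b)) (.inr (EReal.coe_ne_top b)))
      (hmul.prodMk continuousAt_const)

theorem neg_coe_mul_add {a : ℝ} (ha : 0 ≤ a) (b : ℝ) (x : EReal) :
    -((a : EReal) * (x + b)) = -((a : EReal) * x) + ((-(a * b) : ℝ) : EReal) := by
  rw [EReal.left_distrib_of_nonneg_of_ne_top (EReal.coe_nonneg.2 ha) (EReal.coe_ne_top a),
    ← EReal.coe_mul, EReal.neg_add (.inr (EReal.coe_ne_top _)) (.inr (EReal.coe_ne_bot _)),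
    sub_eq_add_neg, EReal.coe_neg]

theorem elog_of_pos {z : ℝ} (hz : 0 < z) : elog z = (Real.log z : EReal) :=
  ENNReal.log_ofReal_of_pos hz

theorem strictMonoOn_elog : StrictMonoOn elog (Ici 0) := fun _ hx _ _ hxy =>
  ENNReal.log_strictMono ((ENNReal.ofReal_lt_ofReal_iff (lt_of_le_of_lt hx hxy)).2 hxy)

theorem continuous_elog : Continuous elog :=
  ENNReal.continuous_log.comp ENNReal.continuous_ofReal

theorem elog_mul {x y : ℝ} (hx : 0 ≤ x) : elog (x * y) = elog x + elog y := by
  rw [elog, ENNReal.ofReal_mul hx, ENNReal.log_mul_add, elog, elog]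

end ExtendedReals

/-! ### The functional equation -/

section FunctionalEquation

open scoped NNReal

theorem eq_mul_apply_one_of_map_add {f : ℝ≥0 → ℝ} (hadd : ∀ c d, f (c + d) = f c + f d)
    (hnonneg : ∀ c, 0 ≤ f c) (c : ℝ≥0) : f c = c * f 1 := by
  have hmono {a b : ℝ≥0} (hab : a ≤ b) : f a ≤ f b := by
    rw [← add_tsub_cancel_of_le hab, hadd]
    exact le_add_of_nonneg_right (hnonneg _)
  have hnat (k : ℕ) (a : ℝ≥0) : f (k * a) = k * f a := by
    simpa using map_nsmul (AddMonoidHom.mk' f hadd) k a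
  have hnat_one (k : ℕ) : f k = k * f 1 := by simpa using hnat k 1
  have hclose (k : ℕ) : k * |f c - c * f 1| ≤ f 1 := by
    have hfloor : (⌊k * c⌋₊ : ℝ≥0) ≤ k * c := Nat.floor_le zero_le
    have hfloor' : k * c ≤ ⌊k * c⌋₊ + 1 := (Nat.lt_floor_add_one (k * c)).le
    have hlower := hmono hfloor
    have hupper := hmono hfloor'
    rw [hadd, hnat, hnat_one] at hupper
    rw [hnat, hnat_one] at hlower
    rw [← abs_of_nonneg (Nat.cast_nonneg (α := ℝ) k), ← abs_mul, abs_le]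
    have hfloor_mul := mul_le_mul_of_nonneg_right (NNReal.coe_le_coe.2 hfloor) (hnonneg 1)
    have hfloor_mul' := mul_le_mul_of_nonneg_right (NNReal.coe_le_coe.2 hfloor') (hnonneg 1)
    push_cast at hfloor_mul hfloor_mul'
    constructor <;> linarith
  by_contra hne
  obtain ⟨k, hk⟩ := Archimedean.arch (f 1 + 1) (abs_pos.2 (sub_ne_zero.2 hne))
  rw [nsmul_eq_mul] at hk
  linarith [hclose k]

theorem one_le_and_nonneg_of_le_mul_add {a b : ℝ} (h : ∀ x, 0 < x → x ≤ a * x + b) :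
    1 ≤ a ∧ 0 ≤ b := by
  have hslope : 1 ≤ a := by
    by_contra! ha
    have hx := h (|b| / (1 - a) + 1) (by have := sub_pos.2 ha; positivity)
    have : (1 - a) * (|b| / (1 - a)) = |b| := mul_div_cancel₀ _ (sub_pos.2 ha).ne'
    linarith [le_abs_self b]
  refine ⟨hslope, not_lt.1 fun hb => ?_⟩
  have hx := h (-b / (2 * a)) (div_pos (by linarith) (by linarith))
  have : a * (-b / (2 * a)) = -b / 2 := by field_simp
  have : 0 < -b / (2 * a) := div_pos (by linarith) (by linarith)
  linarith

theorem eq_add_sub_of_sub_eq_sub {g G : ℝ → ℝ}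
    (hG : ∀ x y, 0 < x → x ≤ y → g y - g x = G y - G x) {z : ℝ} (hz : 0 < z) :
    g z = G z + (g 1 - G 1) := by
  rcases le_total z 1 with hz1 | hz1
  · linarith [hG z 1 hz hz1]
  · linarith [hG 1 z one_pos hz1]

/-- The affine maps `x ↦ A c * x + B c`, `c ≥ 0`, of `(0, ∞)` are conjugated by the strictly
increasing function `g` to the translations by `c`. -/
structure ConjugatesToTranslations (g : ℝ → ℝ) (A B : ℝ≥0 → ℝ) : Prop where
  strictMonoOn : StrictMonoOn g (Ioi 0)
  pos : ∀ c x, 0 < x → 0 < A c * x + B c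
  map : ∀ c x, 0 < x → g (A c * x + B c) = g x + c

namespace ConjugatesToTranslations

variable {g : ℝ → ℝ} {A B : ℝ≥0 → ℝ} (h : ConjugatesToTranslations g A B)

include h

theorem one_le_slope_and_nonneg_intercept (c : ℝ≥0) : 1 ≤ A c ∧ 0 ≤ B c := by
  refine one_le_and_nonneg_of_le_mul_add fun x hx => ?_
  rw [← h.strictMonoOn.le_iff_le hx (h.pos c x hx), h.map c x hx]
  exact le_add_of_nonneg_right c.2

theorem slope_pos (c : ℝ≥0) : 0 < A c :=
  one_pos.trans_le (h.one_le_slope_and_nonneg_intercept c).1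

theorem apply_add (c d : ℝ≥0) {x : ℝ} (hx : 0 < x) :
    A (c + d) * x + B (c + d) = A c * (A d * x + B d) + B c := by
  refine h.strictMonoOn.injOn (h.pos _ x hx) (h.pos c _ (h.pos d x hx)) ?_
  rw [h.map _ x hx, h.map c _ (h.pos d x hx), h.map d x hx, NNReal.coe_add]
  ring

theorem slope_add (c d : ℝ≥0) : A (c + d) = A c * A d := by
  linarith [h.apply_add c d one_pos, h.apply_add c d two_pos]

theorem intercept_add (c d : ℝ≥0) : B (c + d) = A c * B d + B c := by
  linarith [h.apply_add c d one_pos, h.apply_add c d two_pos]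

theorem log_slope (c : ℝ≥0) : Real.log (A c) = c * Real.log (A 1) :=
  eq_mul_apply_one_of_map_add (f := fun c => Real.log (A c))
    (fun c d => by rw [h.slope_add, Real.log_mul (h.slope_pos c).ne' (h.slope_pos d).ne'])
    (fun c => Real.log_nonneg (h.one_le_slope_and_nonneg_intercept c).1) c

theorem slope_eq_one (h1 : A 1 = 1) (c : ℝ≥0) : A c = 1 :=
  Real.eq_one_of_pos_of_log_eq_zero (h.slope_pos c)
    (by rw [h.log_slope, h1, Real.log_one, mul_zero])

theorem intercept_eq_of_slope_eq_one (h1 : A 1 = 1) (c : ℝ≥0) : B c = c * B 1 :=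
  eq_mul_apply_one_of_map_add
    (fun c d => by rw [h.intercept_add, h.slope_eq_one h1, one_mul, add_comm])
    (fun c => (h.one_le_slope_and_nonneg_intercept c).2) c

theorem intercept_one_pos_of_slope_eq_one (h1 : A 1 = 1) : 0 < B 1 := by
  have hlt : (1 : ℝ) < A 1 * 1 + B 1 := by
    rw [← h.strictMonoOn.lt_iff_lt (mem_Ioi.2 one_pos) (h.pos 1 1 one_pos), h.map 1 1 one_pos]
    simp
  linarith

theorem intercept_mul_slope_one_sub_one (c : ℝ≥0) : B c * (A 1 - 1) = B 1 * (A c - 1) := by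
  have hcomm := h.intercept_add c 1
  rw [add_comm c 1, h.intercept_add 1 c] at hcomm
  linarith

theorem eq_affine_of_slope_eq_one (h1 : A 1 = 1) {z : ℝ} (hz : 0 < z) :
    g z = z / B 1 + (g 1 - 1 / B 1) := by
  have hB1 := h.intercept_one_pos_of_slope_eq_one h1
  refine eq_add_sub_of_sub_eq_sub (g := g) (G := fun z => z / B 1) (fun x y hx hxy => ?_) hz
  lift (y - x) / B 1 to ℝ≥0 using div_nonneg (sub_nonneg.2 hxy) hB1.le with c hc
  have hy : A c * x + B c = y := by
    rw [h.slope_eq_one h1, h.intercept_eq_of_slope_eq_one h1, hc]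
    field_simp
    ring
  rw [← hy, h.map c x hx, hy, ← sub_div, ← hc]
  ring

theorem eq_log_of_one_lt_slope (h1 : 1 < A 1) {z : ℝ} (hz : 0 < z) :
    g z = Real.log (B 1 / (A 1 - 1) + z) / Real.log (A 1) +
      (g 1 - Real.log (B 1 / (A 1 - 1) + 1) / Real.log (A 1)) := by
  set l := B 1 / (A 1 - 1) with hl
  have hlog : 0 < Real.log (A 1) := Real.log_pos h1
  have hA1 : 0 < A 1 - 1 := sub_pos.2 h1
  have hl0 : 0 ≤ l := div_nonneg (h.one_le_slope_and_nonneg_intercept 1).2 hA1.le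
  refine eq_add_sub_of_sub_eq_sub (G := fun z => Real.log (l + z) / Real.log (A 1))
    (fun x y hx hxy => ?_) hz
  have hlx : 0 < l + x := by linarith
  have hly : 0 < l + y := by linarith
  have hle : Real.log (l + x) ≤ Real.log (l + y) := Real.log_le_log hlx (by linarith)
  lift (Real.log (l + y) - Real.log (l + x)) / Real.log (A 1) to ℝ≥0
    using div_nonneg (sub_nonneg.2 hle) hlog.le with c hc
  have hslope : A c * (l + x) = l + y := by
    rw [← Real.exp_log (h.slope_pos c), h.log_slope, hc, div_mul_cancel₀ _ hlog.ne', Real.exp_sub,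
      Real.exp_log hlx, Real.exp_log hly, div_mul_cancel₀ _ hlx.ne']
  have hintercept : B c = l * (A c - 1) := by
    rw [hl, div_mul_eq_mul_div, eq_div_iff hA1.ne', h.intercept_mul_slope_one_sub_one]
  have hy : A c * x + B c = y := by linarith
  rw [← hy, h.map c x hx, hy, ← sub_div, ← hc]
  ring

theorem affine_or_log :
    (∃ a b : ℝ, 0 < a ∧ ∀ z, 0 < z → g z = a * z + b) ∨
      ∃ a b l : ℝ, 0 < a ∧ 0 ≤ l ∧ ∀ z, 0 < z → g z = a * Real.log (l + z) + b := by
  obtain ⟨hA, hB⟩ := h.one_le_slope_and_nonneg_intercept 1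
  rcases hA.eq_or_lt with h1 | h1
  · refine .inl ⟨1 / B 1, g 1 - 1 / B 1, ?_, fun z hz => ?_⟩
    · exact one_div_pos.2 (h.intercept_one_pos_of_slope_eq_one h1.symm)
    · rw [h.eq_affine_of_slope_eq_one h1.symm hz, div_mul_eq_mul_div, one_mul]
  · refine .inr ⟨1 / Real.log (A 1), g 1 - Real.log (B 1 / (A 1 - 1) + 1) / Real.log (A 1),
      B 1 / (A 1 - 1), one_div_pos.2 (Real.log_pos h1), div_nonneg hB (sub_pos.2 h1).le,
      fun z hz => ?_⟩
    rw [h.eq_log_of_one_lt_slope h1 hz, div_mul_eq_mul_div, one_mul]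

end ConjugatesToTranslations

end FunctionalEquation

/-! ### Step densities -/

/-- Disjoint measurable sets `S i` of prescribed finite measure `c i`, the level sets of the step
densities below. -/
structure IsCellFamily {X ι : Type*} [MeasurableSpace X] (μ : Measure X) (S : ι → Set X)
    (c : ι → ℝ) : Prop where
  measurableSet : ∀ i, MeasurableSet (S i)
  pairwise_disjoint : Pairwise (Function.onFun Disjoint S)
  nonneg : ∀ i, 0 ≤ c i
  measure_eq : ∀ i, μ (S i) = ENNReal.ofReal (c i)

section Existence

variable {ι κ : Type*}

theorem isCellFamily_Ioc_sum [LinearOrder ι] [LocallyFiniteOrderBot ι] {c : ι → ℝ}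
    (hc : ∀ i, 0 ≤ c i) :
    IsCellFamily volume
      (fun i => Ioc (∑ j ∈ Finset.Iio i, c j) (∑ j ∈ Finset.Iio i, c j + c i)) c where
  measurableSet _ := measurableSet_Ioc
  pairwise_disjoint := by
    refine pairwise_disjoint_on _ |>.2 fun i j hij => ?_
    refine disjoint_left.2 fun x hxi hxj => hxj.1.not_ge (hxi.2.trans ?_)
    rw [add_comm, ← Finset.sum_insert Finset.notMem_Iio_self, Finset.Iio_insert]
    exact Finset.sum_le_sum_of_subset_of_nonneg
      (fun k hk => Finset.mem_Iio.2 ((Finset.mem_Iic.1 hk).trans_lt hij)) fun k _ _ => hc k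
  nonneg := hc
  measure_eq _ := by rw [Real.volume_Ioc, add_sub_cancel_left]

theorem measurableSet_pi_update_Ioc [Countable κ] [DecidableEq κ] (k : κ) {I : Set ℝ}
    (hI : MeasurableSet I) :
    MeasurableSet (univ.pi (Function.update (fun _ => Ioc (0 : ℝ) 1) k I)) :=
  MeasurableSet.univ_pi <| (Function.forall_update_iff _ fun _ s => MeasurableSet s).2
    ⟨hI, fun _ _ => measurableSet_Ioc⟩

variable [Fintype κ] [DecidableEq κ]

/-- The points of `ℝ^κ` with coordinate `k` in `I` and the other coordinates in `(0, 1]`; it has the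
volume of `I`. -/
def slab (k : κ) (I : Set ℝ) : Set (EuclideanSpace ℝ κ) :=
  WithLp.ofLp ⁻¹' univ.pi (Function.update (fun _ => Ioc 0 1) k I)

theorem volume_slab (k : κ) {I : Set ℝ} (hI : MeasurableSet I) : volume (slab k I) = volume I := by
  rw [slab, (PiLp.volume_preserving_ofLp κ).measure_preimage
    (measurableSet_pi_update_Ioc k hI).nullMeasurableSet, volume_pi_pi,
    Finset.prod_eq_single k (fun i _ hi => by simp [hi]) (by simp), Function.update_self]

theorem IsCellFamily.slab {S : ι → Set ℝ} {c : ι → ℝ} (hS : IsCellFamily volume S c) (k : κ) :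
    IsCellFamily volume (fun i => slab k (S i)) c where
  measurableSet i := (PiLp.volume_preserving_ofLp κ).measurable
    (measurableSet_pi_update_Ioc k (hS.measurableSet i))
  pairwise_disjoint i j hij := disjoint_left.2 fun x hxi hxj => by
    have hki := hxi k (mem_univ k)
    have hkj := hxj k (mem_univ k)
    rw [Function.update_self] at hki hkj
    exact disjoint_left.1 (hS.pairwise_disjoint hij) hki hkj
  nonneg := hS.nonneg
  measure_eq i := by rw [volume_slab k (hS.measurableSet i), hS.measure_eq]

omit [DecidableEq κ] in
theorem exists_isCellFamily [LinearOrder ι] [LocallyFiniteOrderBot ι] [Nonempty κ] {c : ι → ℝ}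
    (hc : ∀ i, 0 ≤ c i) :
    ∃ S : ι → Set (EuclideanSpace ℝ κ), IsCellFamily volume S c := by
  classical exact ⟨_, (isCellFamily_Ioc_sum hc).slab (Classical.arbitrary κ)⟩

end Existence

/-- The step function with value `a i` on `S i`, where the sets `S i` are disjoint, and `0`
elsewhere. -/
def stepFn {X ι : Type*} [Fintype ι] (S : ι → Set X) (a : ι → ℝ) (x : X) : ℝ :=
  ∑ i, (S i).indicator (fun _ => a i) x

section StepFn

variable {X ι : Type*} [Fintype ι] {S : ι → Set X} {a b c : ι → ℝ}

theorem stepFn_of_mem (hS : Pairwise (Function.onFun Disjoint S)) {i : ι} {x : X} (hx : x ∈ S i) :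
    stepFn S a x = a i := by
  rw [stepFn, Finset.sum_eq_single i, indicator_of_mem hx]
  · exact fun j _ hji => indicator_of_notMem (disjoint_left.1 (hS hji.symm) hx) _
  · simp

theorem stepFn_of_forall_notMem {x : X} (hx : ∀ i, x ∉ S i) : stepFn S a x = 0 :=
  Finset.sum_eq_zero fun i _ => indicator_of_notMem (hx i) _

theorem apply₂_stepFn (hS : Pairwise (Function.onFun Disjoint S)) {F : ℝ → ℝ → ℝ}
    (hF : F 0 0 = 0) (x : X) :
    F (stepFn S a x) (stepFn S b x) = stepFn S (fun i => F (a i) (b i)) x := by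
  by_cases hx : ∃ i, x ∈ S i
  · obtain ⟨i, hi⟩ := hx
    simp only [stepFn_of_mem hS hi]
  · simp only [stepFn_of_forall_notMem (not_exists.1 hx), hF]

theorem stepFn_nonneg (ha : ∀ i, 0 ≤ a i) (x : X) : 0 ≤ stepFn S a x :=
  Finset.sum_nonneg fun i _ => indicator_nonneg (fun _ _ => ha i) x

theorem stepFn_le_one (hS : Pairwise (Function.onFun Disjoint S)) (ha : ∀ i, a i ≤ 1) (x : X) :
    stepFn S a x ≤ 1 := by
  by_cases hx : ∃ i, x ∈ S i
  · obtain ⟨i, hi⟩ := hx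
    exact (stepFn_of_mem hS hi).trans_le (ha i)
  · exact (stepFn_of_forall_notMem (not_exists.1 hx)).trans_le zero_le_one

variable [MeasurableSpace X] {μ : Measure X}

namespace IsCellFamily

variable (hS : IsCellFamily μ S c)

include hS

omit [Fintype ι] in
theorem integrable_indicator (i : ι) (r : ℝ) : Integrable ((S i).indicator fun _ => r) μ :=
  (integrableOn_const (by simp [hS.measure_eq])).integrable_indicator (hS.measurableSet i)

theorem measurable_stepFn : Measurable (stepFn S a) :=
  Finset.measurable_fun_sum _ fun i _ => measurable_const.indicator (hS.measurableSet i)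

theorem integrable_stepFn : Integrable (stepFn S a) μ :=
  integrable_finsetSum _ fun i _ => hS.integrable_indicator i (a i)

theorem integral_stepFn : ∫ x, stepFn S a x ∂μ = ∑ i, c i * a i := by
  simp only [stepFn]
  rw [integral_finsetSum _ fun i _ => hS.integrable_indicator i (a i)]
  refine Finset.sum_congr rfl fun i _ => ?_
  rw [integral_indicator_const _ (hS.measurableSet i), Measure.real, hS.measure_eq,
    ENNReal.toReal_ofReal (hS.nonneg i), smul_eq_mul]

end IsCellFamily

end StepFn

section StepDensity

variable {n : ℕ} {Γ : Set ℝ} {ι : Type*} [Fintype ι] {S : ι → Set (EuclideanSpace ℝ (Fin n))}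
  {a b c : ι → ℝ} (hS : IsCellFamily volume S c)

include hS

theorem rpow_stepFn {r : ℝ} (hr : r ≠ 0) (x : EuclideanSpace ℝ (Fin n)) :
    stepFn S a x ^ r = stepFn S (fun i => a i ^ r) x :=
  apply₂_stepFn (a := a) (b := a) hS.pairwise_disjoint (F := fun s _ => s ^ r) (Real.zero_rpow hr) x

theorem stepFn_mem_densities (hΓ : ∀ γ ∈ Γ, 0 ≤ γ) (ha : ∀ i, 0 ≤ a i)
    (hsum : ∑ i, c i * a i = 1) : stepFn S a ∈ densities n Γ := by
  refine ⟨hS.measurable_stepFn, stepFn_nonneg ha, hS.integrable_stepFn,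
    hS.integral_stepFn.trans hsum, fun γ hγ => ?_⟩
  have hγ : 1 + γ ≠ 0 := by linarith [hΓ γ hγ]
  simpa only [rpow_stepFn hS hγ] using hS.integrable_stepFn

theorem power_stepFn {γ : ℝ} (hγ : 1 + γ ≠ 0) :
    power γ (stepFn S b) = ∑ i, c i * b i ^ (1 + γ) := by
  simp only [power, rpow_stepFn hS hγ, hS.integral_stepFn]

theorem cross_stepFn {γ : ℝ} :
    cross γ (stepFn S a) (stepFn S b) = ∑ i, c i * (a i * b i ^ γ) := by
  simp only [cross, apply₂_stepFn hS.pairwise_disjoint (F := fun s t => s * t ^ γ) (zero_mul _),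
    hS.integral_stepFn]

theorem shannon_stepFn_eq_top (hb : ∀ i, b i ≤ 1) {i : ι} (hci : 0 < c i) (hai : 0 < a i)
    (hbi : b i = 0) : shannon (stepFn S a) (stepFn S b) = ⊤ := by
  have hpos : ∫⁻ x, ENNReal.ofReal (stepFn S a x) *
      (ENNReal.log (ENNReal.ofReal (stepFn S b x))).toENNReal = 0 := by
    refine (lintegral_congr fun x => ?_).trans lintegral_zero
    rw [EReal.toENNReal_of_nonpos, mul_zero]
    exact ENNReal.log_le_zero_iff.2
      (ENNReal.ofReal_le_one.2 (stepFn_le_one hS.pairwise_disjoint hb x))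
  have hneg : ∫⁻ x, ENNReal.ofReal (stepFn S a x) *
      (-ENNReal.log (ENNReal.ofReal (stepFn S b x))).toENNReal = ⊤ := by
    refine top_unique ?_
    calc (⊤ : ℝ≥0∞) = ∫⁻ x, (S i).indicator (fun _ => ⊤) x := by
          rw [lintegral_indicator_const (hS.measurableSet i), hS.measure_eq,
            ENNReal.top_mul (ENNReal.ofReal_pos.2 hci).ne']
      _ ≤ _ := lintegral_mono <| indicator_le' (fun x hx => ?_) fun _ _ => zero_le
    rw [stepFn_of_mem hS.pairwise_disjoint hx, stepFn_of_mem hS.pairwise_disjoint hx, hbi,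
      ENNReal.ofReal_zero, ENNReal.log_zero, EReal.neg_bot, EReal.toENNReal_top,
      ENNReal.mul_top (ENNReal.ofReal_pos.2 hai).ne']
  rw [shannon, hpos, hneg]
  simp

end StepDensity

/-! ### Cross terms of step densities -/

section Separation

variable {n : ℕ} {Γ : Set ℝ}

theorem cross_nonneg (γ : ℝ) (q p : densities n Γ) : 0 ≤ cross γ q.1 p.1 :=
  integral_nonneg fun x => mul_nonneg (q.2.2.1 x) (Real.rpow_nonneg (p.2.2.1 x) _)

theorem power_pos {γ : ℝ} (hγΓ : γ ∈ Γ) (hγ : 0 < γ) (p : densities n Γ) : 0 < power γ p.1 := by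
  obtain ⟨-, hp, -, hintegral, hpow⟩ := p.2
  have hnonneg : 0 ≤ fun x => p.1 x ^ (1 + γ) := fun x => Real.rpow_nonneg (hp x) _
  refine (integral_nonneg hnonneg).lt_of_ne' fun h0 => ?_
  have hae : p.1 =ᵐ[volume] fun _ => 0 := by
    filter_upwards [(integral_eq_zero_iff_of_nonneg hnonneg (hpow γ hγΓ)).1 h0] with x hx
    exact (Real.rpow_eq_zero (hp x) (by linarith)).1 hx
  rw [integral_congr_ae hae, integral_zero] at hintegral
  exact zero_ne_one hintegral

/-- The part of a power cross-entropy with exponent `γ` that depends on both densities. -/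
def crossTerm (γ : ℝ) (q p : EuclideanSpace ℝ (Fin n) → ℝ) : EReal :=
  if γ = 0 then shannon q p else cross γ q p

theorem crossTerm_of_pos {γ : ℝ} (hγ : 0 < γ) (q p : EuclideanSpace ℝ (Fin n) → ℝ) :
    crossTerm γ q p = cross γ q p := if_neg hγ.ne'

theorem forall_vec_three_nonneg {x y z : ℝ} (hx : 0 ≤ x) (hy : 0 ≤ y) (hz : 0 ≤ z) :
    ∀ i, 0 ≤ ![x, y, z] i := by
  simp [Fin.forall_fin_succ, hx, hy, hz]

variable [NeZero n]

theorem exists_cross_eq_power_eq (hΓ : ∀ γ ∈ Γ, 0 ≤ γ) {γ x y : ℝ} (hγ : 0 < γ) (hx : 0 ≤ x)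
    (hy : 0 < y) : ∃ q p : densities n Γ, cross γ q.1 p.1 = x ∧ power γ p.1 = y := by
  have hγ1 : 1 + γ ≠ 0 := by positivity
  obtain ⟨h, h_pos, h_rpow⟩ : ∃ h : ℝ, 0 < h ∧ h ^ γ = x + y :=
    ⟨(x + y) ^ γ⁻¹, by positivity, Real.rpow_inv_rpow (by positivity) hγ.ne'⟩
  obtain ⟨s, s_pos, s_rpow⟩ : ∃ s : ℝ, 0 < s ∧ s ^ γ = y / 2 :=
    ⟨(y / 2) ^ γ⁻¹, by positivity, Real.rpow_inv_rpow (by positivity) hγ.ne'⟩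
  -- `p` is `h` and `s` with probabilities `y / (2 * x + y)` and `2 * x / (2 * x + y)`, and `q` puts
  -- the mass `x / (x + y)` on the first level set of `p` and the rest where `p` vanishes.
  obtain ⟨S, hS⟩ := exists_isCellFamily (κ := Fin n)
    (c := ![y / ((2 * x + y) * h), 2 * x / ((2 * x + y) * s), 1])
    (forall_vec_three_nonneg (by positivity) (by positivity) zero_le_one)
  let q := stepFn S ![x / (x + y) * ((2 * x + y) * h / y), 0, y / (x + y)]
  let p := stepFn S ![h, s, 0]
  have hq : q ∈ densities n Γ := by
    refine stepFn_mem_densities hS hΓ (forall_vec_three_nonneg ?_ le_rfl ?_) ?_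
    · positivity
    · positivity
    · simp only [Fin.sum_univ_three, Matrix.cons_val]
      field_simp
      ring
  have hp : p ∈ densities n Γ := by
    refine stepFn_mem_densities hS hΓ (forall_vec_three_nonneg h_pos.le s_pos.le le_rfl) ?_
    simp only [Fin.sum_univ_three, Matrix.cons_val]
    field_simp
    ring
  refine ⟨⟨q, hq⟩, ⟨p, hp⟩, ?_, ?_⟩
  · simp only [q, p, cross_stepFn hS, Fin.sum_univ_three, Matrix.cons_val, h_rpow,
      Real.zero_rpow hγ.ne']
    field_simp
    ring
  · simp only [p, power_stepFn hS hγ1, Fin.sum_univ_three, Matrix.cons_val, Real.rpow_add h_pos,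
      Real.rpow_add s_pos, Real.rpow_one, h_rpow, s_rpow, Real.zero_rpow hγ1]
    field_simp
    ring

theorem exists_shannon_eq_cross_ne (hΓ : ∀ γ ∈ Γ, 0 ≤ γ) {γ : ℝ} (hγ : 0 < γ) :
    ∃ q q' p : densities n Γ, shannon q.1 p.1 = shannon q'.1 p.1 ∧
      cross γ q.1 p.1 ≠ cross γ q'.1 p.1 := by
  obtain ⟨S, hS⟩ := exists_isCellFamily (κ := Fin n) (c := ![1, 1]) (by simp [Fin.forall_fin_succ])
  have hmem {x y : ℝ} (hx : 0 ≤ x) (hy : 0 ≤ y) (hxy : x + y = 1) :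
      stepFn S ![x, y] ∈ densities n Γ :=
    stepFn_mem_densities hS hΓ (by simp [Fin.forall_fin_succ, hx, hy]) (by simpa using hxy)
  have htop {x y : ℝ} (hy : 0 < y) : shannon (stepFn S ![x, y]) (stepFn S ![1, 0]) = ⊤ :=
    shannon_stepFn_eq_top hS (by simp [Fin.forall_fin_succ]) (i := 1) one_pos hy rfl
  refine ⟨⟨stepFn S ![0, 1], hmem le_rfl zero_le_one (zero_add 1)⟩,
    ⟨stepFn S ![1 / 2, 1 / 2], hmem one_half_pos.le one_half_pos.le (add_halves 1)⟩,
    ⟨stepFn S ![1, 0], hmem zero_le_one le_rfl (add_zero 1)⟩,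
    (htop one_pos).trans (htop one_half_pos).symm, ?_⟩
  simp [cross_stepFn hS, Real.zero_rpow hγ.ne']

theorem exists_cross_eq_cross_ne (hΓ : ∀ γ ∈ Γ, 0 ≤ γ) {γ γ' : ℝ} (hγ : 0 < γ) (hγ' : 0 < γ')
    (hne : γ ≠ γ') : ∃ q q' p : densities n Γ, cross γ q.1 p.1 = cross γ q'.1 p.1 ∧
      cross γ' q.1 p.1 ≠ cross γ' q'.1 p.1 := by
  obtain ⟨S, hS⟩ := exists_isCellFamily (κ := Fin n) (c := ![1, 1 / 2, 1])
    (forall_vec_three_nonneg zero_le_one one_half_pos.le zero_le_one)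
  have hmem {x y z : ℝ} (hx : 0 ≤ x) (hy : 0 ≤ y) (hz : 0 ≤ z) (hsum : x + 1 / 2 * y + z = 1) :
      stepFn S ![x, y, z] ∈ densities n Γ :=
    stepFn_mem_densities hS hΓ (forall_vec_three_nonneg hx hy hz)
      (by simpa [Fin.sum_univ_three] using hsum)
  have hle : (1 / 2 : ℝ) ^ γ ≤ 1 := Real.rpow_le_one (by norm_num) (by norm_num) hγ.le
  refine ⟨⟨stepFn S ![1, 0, 0], hmem zero_le_one le_rfl le_rfl (by norm_num)⟩,
    ⟨stepFn S ![0, 2 * (1 / 2) ^ γ, 1 - (1 / 2) ^ γ],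
      hmem le_rfl (by positivity) (sub_nonneg.2 hle) (by ring)⟩,
    ⟨stepFn S ![1 / 2, 1, 0], hmem one_half_pos.le zero_le_one le_rfl (by norm_num)⟩, ?_, ?_⟩
  · simp [cross_stepFn hS, Fin.sum_univ_three, Real.zero_rpow hγ.ne']
  · simpa [cross_stepFn hS, Fin.sum_univ_three, Real.zero_rpow hγ'.ne', Real.rpow_right_inj] using
      hne.symm

theorem exists_crossTerm_eq_cross_ne (hΓ : ∀ γ ∈ Γ, 0 ≤ γ) {γ γ' : ℝ} (hγ : 0 ≤ γ) (hγ' : 0 < γ')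
    (hne : γ ≠ γ') : ∃ q q' p : densities n Γ, crossTerm γ q.1 p.1 = crossTerm γ q'.1 p.1 ∧
      cross γ' q.1 p.1 ≠ cross γ' q'.1 p.1 := by
  rcases hγ.eq_or_lt with rfl | hγ
  · simpa only [crossTerm, if_true] using exists_shannon_eq_cross_ne hΓ hγ'
  · simpa only [crossTerm_of_pos hγ, EReal.coe_eq_coe_iff] using
      exists_cross_eq_cross_ne hΓ hγ hγ' hne

end Separation

/-! ### Norm-based cross-entropies -/

section NormBased

variable {n : ℕ} {φ : ℝ → ℝ → ℝ}

theorem IsNBGenerator.deriv_pos (hφ : IsNBGenerator φ) {γ z : ℝ} (hγ : 0 ≤ γ) (hz : 0 < z) :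
    0 < deriv (φ γ) z := by
  have hslope : 0 < slope (φ γ) 0 z := by
    rw [slope_def_field]
    exact div_pos (sub_pos.2 (hφ.strictMono γ hγ self_mem_Ici hz.le hz)) (sub_pos.2 hz)
  exact hslope.trans_le ((hφ.convex γ hγ).slope_le_deriv self_mem_Ici hz.le hz
    (hφ.differentiable γ hγ z hz))

/-- For fixed `p`, the norm-based Bregman cross-entropy is a decreasing affine function of the cross
term `⟨q p ^ γ⟩`; this is the negative of its slope, as a function of `y = ⟨p ^ (1 + γ)⟩`. -/
def nbSlope (φ : ℝ → ℝ → ℝ) (γ y : ℝ) : ℝ :=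
  deriv (φ γ) (y ^ (1 / (1 + γ))) / (γ * (y ^ (1 / (1 + γ))) ^ γ)

/-- The negative of the intercept of the affine function whose slope is `-nbSlope φ γ y`. -/
def nbIntercept (φ : ℝ → ℝ → ℝ) (γ y : ℝ) : ℝ :=
  (φ γ (y ^ (1 / (1 + γ))) - φ 0 1) / γ - nbSlope φ γ y * y

theorem nbCE_eq (φ : ℝ → ℝ → ℝ) {γ : ℝ} (hγ : γ ≠ 0) (q p : EuclideanSpace ℝ (Fin n) → ℝ) :
    nbCE φ γ q p =
      ((-(nbSlope φ γ (power γ p) * cross γ q p + nbIntercept φ γ (power γ p)) : ℝ) : EReal) := by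
  rw [nbCE, if_neg hγ, nbIntercept, nbSlope, powerNorm]
  congr 1
  ring

theorem nbCE_congr {γ : ℝ} {q q' p : EuclideanSpace ℝ (Fin n) → ℝ}
    (h : crossTerm γ q p = crossTerm γ q' p) : nbCE φ γ q p = nbCE φ γ q' p := by
  by_cases hγ : γ = 0
  · simp only [crossTerm, if_pos hγ] at h
    simp only [nbCE, if_pos hγ, h]
  · simp only [crossTerm, if_neg hγ, EReal.coe_eq_coe_iff] at h
    rw [nbCE_eq φ hγ, nbCE_eq φ hγ, h]

theorem IsNBGenerator.nbSlope_pos (hφ : IsNBGenerator φ) {γ y : ℝ} (hγ : 0 < γ) (hy : 0 < y) :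
    0 < nbSlope φ γ y := by
  have hnorm : 0 < y ^ (1 / (1 + γ)) := Real.rpow_pos_of_pos hy _
  exact div_pos (hφ.deriv_pos hγ.le hnorm) (mul_pos hγ (Real.rpow_pos_of_pos hnorm _))

theorem IsNBGenerator.cross_eq_of_nbCE_eq (hφ : IsNBGenerator φ) {γ : ℝ} (hγ : 0 < γ)
    {q q' p : EuclideanSpace ℝ (Fin n) → ℝ} (hp : 0 < power γ p)
    (h : nbCE φ γ q p = nbCE φ γ q' p) : cross γ q p = cross γ q' p := by
  rw [nbCE_eq φ hγ.ne', nbCE_eq φ hγ.ne', EReal.coe_eq_coe_iff, neg_inj, add_left_inj] at h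
  exact mul_left_cancel₀ (hφ.nbSlope_pos hγ hp).ne' h

theorem IsNBGenerator.equivalent_shannon_nbCE (hφ : IsNBGenerator φ) {Γ : Set ℝ} :
    Equivalent (n := n) (Γ := Γ) (fun q p => shannon q.1 p.1) (fun q p => nbCE φ 0 q.1 p.1) :=
  equivalent_of_strictMono (strictMono_coe_mul_add_coe (hφ.deriv_pos le_rfl one_pos) _)
    fun q p => by rw [nbCE, if_pos rfl, sub_eq_add_neg, ← EReal.coe_neg]

end NormBased

/-! ### Functional cross-entropies -/

section Functional

variable {v : ℝ → EReal}

theorem coe_toReal_of_strictMonoOn (hv : StrictMonoOn v (Ici 0)) {z : ℝ} (hz : 0 < z) :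
    ((v z).toReal : EReal) = v z :=
  EReal.coe_toReal (hv hz.le (hz.trans (lt_add_one z)).le (lt_add_one z)).ne_top
    (hv self_mem_Ici hz.le hz).ne_bot

theorem isFDPGenerator_iff : IsFDPGenerator v ↔
    StrictMonoOn v (Ici 0) ∧ ConvexOn ℝ univ fun x => (v (Real.exp x)).toReal := by
  have hconvex (hv : StrictMonoOn v (Ici 0)) (x y s t : ℝ) :
      v (Real.exp (s * x + t * y)) ≤ (s : EReal) * v (Real.exp x) + (t : EReal) * v (Real.exp y) ↔
        (v (Real.exp (s • x + t • y))).toReal ≤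
          s • (v (Real.exp x)).toReal + t • (v (Real.exp y)).toReal := by
    rw [← EReal.coe_le_coe_iff, EReal.coe_add]
    simp only [smul_eq_mul, EReal.coe_mul, coe_toReal_of_strictMonoOn hv (Real.exp_pos _)]
  constructor
  · rintro ⟨hmono, hle⟩
    exact ⟨hmono, convex_univ, fun x _ y _ s t hs ht hst =>
      (hconvex hmono x y s t).1 (hle x y s t hs ht hst)⟩
  · rintro ⟨hmono, -, hle⟩
    exact ⟨hmono, fun x y s t hs ht hst =>
      (hconvex hmono x y s t).2 (hle (mem_univ x) (mem_univ y) hs ht hst)⟩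

theorem tendsto_atTop_of_convexOn_of_strictMono {f : ℝ → ℝ} (hc : ConvexOn ℝ univ f)
    (hm : StrictMono f) : Filter.Tendsto f Filter.atTop Filter.atTop := by
  have hslope : 0 < f 1 - f 0 := sub_pos.2 (hm one_pos)
  refine Filter.tendsto_atTop_mono' _ ?_ (Filter.tendsto_atTop_add_const_right _ (f 0)
    (Filter.tendsto_id.const_mul_atTop hslope))
  filter_upwards [Filter.eventually_ge_atTop 1] with x hx
  have hx0 : 0 < x := one_pos.trans_le hx
  have hsecant := hc.secant_mono (mem_univ 0) (mem_univ 1) (mem_univ x) one_ne_zero hx0.ne' hx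
  rw [sub_zero, sub_zero, div_one, le_div_iff₀ hx0] at hsecant
  exact le_sub_iff_add_le.1 hsecant

/-- The functional density power cross-entropy as a function of the cross term `x = ⟨q p ^ γ⟩` and
the power term `y = ⟨p ^ (1 + γ)⟩`. -/
def fdpVal (v : ℝ → EReal) (γ x y : ℝ) : EReal :=
  -((((1 + γ) / γ : ℝ) : EReal) * v x) + ((1 / γ : ℝ) : EReal) * v 1 + v y

theorem fdpCE_eq (v : ℝ → EReal) {n : ℕ} {γ : ℝ} (hγ : γ ≠ 0)
    (q p : EuclideanSpace ℝ (Fin n) → ℝ) :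
    fdpCE v γ q p = fdpVal v γ (cross γ q p) (power γ p) := by
  rw [fdpCE, if_neg hγ, fdpVal]

theorem fdpCE_congr {n : ℕ} {γ : ℝ} {q q' p : EuclideanSpace ℝ (Fin n) → ℝ}
    (h : crossTerm γ q p = crossTerm γ q' p) : fdpCE v γ q p = fdpCE v γ q' p := by
  by_cases hγ : γ = 0
  · simp only [crossTerm, if_pos hγ] at h
    simp only [fdpCE, if_pos hγ, h]
  · simp only [crossTerm, if_neg hγ, EReal.coe_eq_coe_iff] at h
    rw [fdpCE_eq v hγ, fdpCE_eq v hγ, h]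

namespace IsFDPGenerator

variable (hv : IsFDPGenerator v)

include hv

theorem coe_toReal {z : ℝ} (hz : 0 < z) : ((v z).toReal : EReal) = v z :=
  coe_toReal_of_strictMonoOn hv.strictMono hz

theorem strictMonoOn_toReal : StrictMonoOn (fun z => (v z).toReal) (Ioi 0) := by
  intro x hx y hy hxy
  rw [← EReal.coe_lt_coe_iff, hv.coe_toReal hx, hv.coe_toReal hy]
  exact hv.strictMono (mem_Ioi.1 hx).le (mem_Ioi.1 hy).le hxy

theorem exists_toReal_eq {x r : ℝ} (hx : 0 < x) (hr : (v x).toReal ≤ r) :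
    ∃ y, 0 < y ∧ (v y).toReal = r := by
  have hconv := (isFDPGenerator_iff.1 hv).2
  have htendsto := tendsto_atTop_of_convexOn_of_strictMono hconv fun s t hst =>
    hv.strictMonoOn_toReal (Real.exp_pos s) (Real.exp_pos t) (Real.exp_lt_exp.2 hst)
  obtain ⟨t, ht⟩ := mem_range_of_exists_le_of_exists_ge
    (continuousOn_univ.1 (hconv.continuousOn isOpen_univ))
    ⟨Real.log x, by rwa [Real.exp_log hx]⟩ (htendsto.eventually_ge_atTop r).exists
  exact ⟨Real.exp t, Real.exp_pos t, ht⟩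

theorem fdpVal_eq_neg_mul_add (γ x : ℝ) {y : ℝ} (hy : 0 < y) :
    fdpVal v γ x y = -((((1 + γ) / γ : ℝ) : EReal) * v x) +
      ((1 / γ * (v 1).toReal + (v y).toReal : ℝ) : EReal) := by
  rw [fdpVal, EReal.coe_add, EReal.coe_mul, hv.coe_toReal one_pos, hv.coe_toReal hy, add_assoc]

theorem fdpVal_eq_coe (γ : ℝ) {x y : ℝ} (hx : 0 < x) (hy : 0 < y) :
    fdpVal v γ x y =
      ((-((1 + γ) / γ * (v x).toReal) + (1 / γ * (v 1).toReal + (v y).toReal) : ℝ) : EReal) := by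
  rw [hv.fdpVal_eq_neg_mul_add γ x hy, EReal.coe_add _ (_ + _), EReal.coe_neg, EReal.coe_mul,
    hv.coe_toReal hx]

theorem strictAntiOn_fdpVal {γ y : ℝ} (hγ : 0 < γ) (hy : 0 < y) :
    StrictAntiOn (fun x => fdpVal v γ x y) (Ici 0) := by
  simp only [hv.fdpVal_eq_neg_mul_add γ _ hy]
  exact (strictAnti_neg_coe_mul_add_coe (by positivity) _).comp_strictMonoOn hv.strictMono

end IsFDPGenerator

/-- The functional density power cross-entropy of `v` orders the pairs `(x, y)` of a cross term and
a power term in the same way as `-(α y * x + β y)`, the form of a norm-based Bregman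
cross-entropy. -/
def OrderedByAffine (v : ℝ → EReal) (γ : ℝ) (α β : ℝ → ℝ) : Prop :=
  ∀ ⦃x x' y y'⦄, 0 ≤ x → 0 ≤ x' → 0 < y → 0 < y' →
    (fdpVal v γ x y < fdpVal v γ x' y' ↔ α y' * x' + β y' < α y * x + β y)

namespace OrderedByAffine

variable {γ : ℝ} {α β : ℝ → ℝ} (h : OrderedByAffine v γ α β) (hv : IsFDPGenerator v) (hγ : 0 < γ)

include h hv hγ

/- If `v` jumped at `0`, from `v 0` to a limit of at least `r > v 0`, some pair `(1, Y)` would have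
the value that `(x, 1)` takes where `v x = r`, and the affine functional would jump as well. -/
theorem exists_lt_of_apply_zero_lt {r : ℝ} (hr : v 0 < r) : ∃ z, 0 < z ∧ v z < r := by
  by_contra! hle
  have hκ : 0 < (1 + γ) / γ := by positivity
  have hr1 : r ≤ (v 1).toReal := by
    rw [← EReal.coe_le_coe_iff, hv.coe_toReal one_pos]
    exact hle 1 one_pos
  obtain ⟨Y, hY0, hY⟩ := hv.exists_toReal_eq (r := (v 1).toReal + (1 + γ) / γ * ((v 1).toReal - r))
    one_pos (le_add_of_nonneg_right (mul_nonneg hκ.le (sub_nonneg.2 hr1)))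
  have hval : fdpVal v γ 1 Y = -((((1 + γ) / γ : ℝ) : EReal) * (r : EReal)) +
      ((1 / γ * (v 1).toReal + (v 1).toReal : ℝ) : EReal) := by
    rw [hv.fdpVal_eq_coe γ one_pos hY0, hY]
    norm_cast
    ring
  have hanti := strictAnti_neg_coe_mul_add_coe hκ (1 / γ * (v 1).toReal + (v 1).toReal)
  have habove : α 1 * 0 + β 1 < α Y * 1 + β Y := by
    rw [← h zero_le_one le_rfl hY0 one_pos, hval, hv.fdpVal_eq_neg_mul_add γ 0 one_pos]
    exact hanti hr
  have hbelow {x : ℝ} (hx : 0 < x) : α Y * 1 + β Y ≤ α 1 * x + β 1 := by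
    rw [← not_lt, ← h zero_le_one hx.le hY0 one_pos, not_lt, hval,
      hv.fdpVal_eq_neg_mul_add γ x one_pos]
    exact hanti.antitone (hle x hx)
  have hcont : ContinuousWithinAt (fun x => α 1 * x + β 1) (Ioi 0) 0 := by fun_prop
  exact habove.not_ge (ge_of_tendsto hcont (eventually_mem_nhdsWithin.mono fun _ => hbelow))

theorem tendsto_apply_zero : Filter.Tendsto v (nhdsWithin 0 (Ioi 0)) (nhds (v 0)) := by
  refine tendsto_order.2 ⟨fun a ha => ?_, fun b hb => ?_⟩
  · filter_upwards [self_mem_nhdsWithin] with z hz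
    exact ha.trans (hv.strictMono self_mem_Ici (mem_Ioi.1 hz).le hz)
  · obtain ⟨r, hr, hrb⟩ := EReal.lt_iff_exists_real_btwn.1 hb
    obtain ⟨z, hz, hzr⟩ := h.exists_lt_of_apply_zero_lt hv hγ hr
    filter_upwards [Ioo_mem_nhdsGT hz] with t ht
    exact ((hv.strictMono ht.1.le hz.le ht.2).trans hzr).trans hrb

theorem eq_of_eq_of_pos {F : ℝ → EReal} (hF : Continuous F) (hvF : ∀ z, 0 < z → v z = F z) :
    ∀ z, 0 ≤ z → v z = F z := fun z hz => by
  rcases hz.eq_or_lt with rfl | hz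
  · refine tendsto_nhds_unique (h.tendsto_apply_zero hv hγ)
      ((hF.continuousWithinAt (s := Ioi 0)).congr' ?_)
    exact eventually_mem_nhdsWithin.mono fun z hz => (hvF z hz).symm
  · exact hvF z hz

/- Raising the power term from `1` to `Y` compensates for an increase of `v x` by `c`, and on the
affine side the compensating change of `x` is affine. -/
theorem exists_conjugatesToTranslations (hα : ∀ y, 0 < y → 0 < α y) :
    ∃ A B, ConjugatesToTranslations (fun z => (v z).toReal) A B := by
  have hκ : 0 < (1 + γ) / γ := by positivity
  choose Y hY0 hY using fun c : NNReal => hv.exists_toReal_eq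
    (r := (v 1).toReal + (1 + γ) / γ * c) one_pos
    (le_add_of_nonneg_right (mul_nonneg hκ.le c.2))
  have hshift (c : NNReal) (x : ℝ) (hx : 0 < x) :
      0 < α 1 / α (Y c) * x + (β 1 - β (Y c)) / α (Y c) ∧
        (v (α 1 / α (Y c) * x + (β 1 - β (Y c)) / α (Y c))).toReal = (v x).toReal + c := by
    obtain ⟨x', hx', hvx'⟩ := hv.exists_toReal_eq (r := (v x).toReal + c) hx
      (le_add_of_nonneg_right c.2)
    have hval : fdpVal v γ x 1 = fdpVal v γ x' (Y c) := by
      rw [hv.fdpVal_eq_coe γ hx one_pos, hv.fdpVal_eq_coe γ hx' (hY0 c), hvx', hY]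
      congr 1
      ring
    have hle := (h hx.le hx'.le one_pos (hY0 c)).not.1 hval.not_lt
    have hge := (h hx'.le hx.le (hY0 c) one_pos).not.1 hval.not_gt
    have heq : α 1 / α (Y c) * x + (β 1 - β (Y c)) / α (Y c) = x' := by
      have := hα _ (hY0 c)
      field_simp
      linarith
    rw [heq]
    exact ⟨hx', hvx'⟩
  exact ⟨_, _, hv.strictMonoOn_toReal, fun c x hx => (hshift c x hx).1, fun c x hx =>
    (hshift c x hx).2⟩

end OrderedByAffine

/-- The generators of the functional density power divergences that are bridge divergences:
increasing affine functions and logarithms of affine functions. -/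
def IsBridgeGenerator (v : ℝ → EReal) : Prop :=
  (∃ a b : ℝ, 0 < a ∧ ∀ z : ℝ, 0 ≤ z → v z = ((a * z + b : ℝ) : EReal)) ∨
    ∃ a b l₁ l₂ : ℝ, 0 < a ∧ 0 ≤ l₁ ∧ 0 < l₂ ∧
      ∀ z : ℝ, 0 ≤ z → v z = (a : EReal) * elog (l₁ + l₂ * z) + (b : EReal)

theorem OrderedByAffine.isBridgeGenerator {γ : ℝ} {α β : ℝ → ℝ} (h : OrderedByAffine v γ α β)
    (hv : IsFDPGenerator v) (hγ : 0 < γ) (hα : ∀ y, 0 < y → 0 < α y) : IsBridgeGenerator v := by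
  obtain ⟨A, B, hAB⟩ := h.exists_conjugatesToTranslations hv hγ hα
  rcases hAB.affine_or_log with ⟨a, b, ha, hab⟩ | ⟨a, b, l, ha, hl, hab⟩
  · refine .inl ⟨a, b, ha, h.eq_of_eq_of_pos hv hγ ?_ fun z hz => ?_⟩
    · exact continuous_coe_real_ereal.comp (by fun_prop)
    · rw [← hv.coe_toReal hz, hab z hz]
  · refine .inr ⟨a, b, l, 1, ha, hl, one_pos, h.eq_of_eq_of_pos hv hγ ?_ fun z hz => ?_⟩
    · exact (continuous_coe_mul_add_coe a b).comp (continuous_elog.comp (by fun_prop))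
    · rw [← hv.coe_toReal hz, hab z hz, one_mul, elog_of_pos (by positivity), EReal.coe_add,
        EReal.coe_mul]

end Functional

/-! ### Bridge cross-entropies -/

section Bridge

variable {n : ℕ} {Γ : Set ℝ}

theorem fdpVal_eq_coe_mul {u v : ℝ → EReal} (hu : IsFDPGenerator u) {a b : ℝ} (ha : 0 ≤ a)
    (hv : ∀ z, 0 ≤ z → v z = a * u z + b) {γ x y : ℝ} (hγ : 0 < γ) (hx : 0 ≤ x) (hy : 0 < y) :
    fdpVal v γ x y = a * fdpVal u γ x y := by
  have hκ : 0 ≤ (1 + γ) / γ := by positivity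
  rw [hu.fdpVal_eq_neg_mul_add γ x hy, EReal.left_distrib_of_nonneg_of_ne_top
    (EReal.coe_nonneg.2 ha) (EReal.coe_ne_top a), mul_neg, ← EReal.coe_mul, fdpVal, hv x hx,
    hv 1 zero_le_one, hv y hy.le, neg_coe_mul_add hκ, mul_left_comm, ← hu.coe_toReal one_pos,
    ← hu.coe_toReal hy, add_assoc, add_assoc]
  congr 1
  norm_cast
  simp only [EReal.toReal_coe]
  field_simp
  ring

/-- The generator for which the functional density power cross-entropy is the bridge cross-entropy
with parameters `l₁`, `l₂`. -/
def bridgeV (l₁ l₂ z : ℝ) : EReal :=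
  if l₂ = 0 then ((z / l₁ : ℝ) : EReal) else ((1 / l₂ : ℝ) : EReal) * elog (l₁ + l₂ * z)

theorem add_mul_pos {l₁ l₂ z : ℝ} (h₁ : 0 ≤ l₁) (h₂ : 0 ≤ l₂) (h₁₂ : 0 < l₁ + l₂) (hz : 0 < z) :
    0 < l₁ + l₂ * z := by
  rcases h₂.eq_or_lt with rfl | h₂
  · simpa using h₁₂
  · positivity

theorem toReal_bridgeV {l₁ l₂ z : ℝ} (hz : 0 < l₁ + l₂ * z) :
    (bridgeV l₁ l₂ z).toReal = if l₂ = 0 then z / l₁ else 1 / l₂ * Real.log (l₁ + l₂ * z) := by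
  rw [bridgeV, elog_of_pos hz, ← EReal.coe_mul]
  split_ifs <;> rfl

theorem hasDerivAt_toReal_bridgeV {l₁ l₂ z : ℝ} (hz : 0 < l₁ + l₂ * z) :
    HasDerivAt (fun z => (bridgeV l₁ l₂ z).toReal) (1 / (l₁ + l₂ * z)) z := by
  have hlin : HasDerivAt (fun y => l₁ + l₂ * y) l₂ z := by
    simpa using ((hasDerivAt_id z).const_mul l₂).const_add l₁
  have hev : ∀ᶠ y in nhds z, 0 < l₁ + l₂ * y :=
    Filter.Tendsto.eventually_const_lt hz hlin.continuousAt
  refine HasDerivAt.congr_of_eventuallyEq ?_ (hev.mono fun y hy => toReal_bridgeV hy)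
  split_ifs with h0
  · simpa [h0] using (hasDerivAt_id z).div_const l₁
  · refine ((hlin.log hz.ne').const_mul (1 / l₂)).congr_deriv ?_
    field_simp

theorem strictMonoOn_bridgeV {l₁ l₂ : ℝ} (h₁ : 0 ≤ l₁) (h₂ : 0 ≤ l₂) (h₁₂ : 0 < l₁ + l₂) :
    StrictMonoOn (bridgeV l₁ l₂) (Ici 0) := fun x hx y hy hxy => by
  rcases h₂.eq_or_lt with rfl | h₂
  · rw [add_zero] at h₁₂
    rw [bridgeV, bridgeV, if_pos rfl, if_pos rfl, EReal.coe_lt_coe_iff]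
    gcongr
  · rw [bridgeV, bridgeV, if_neg h₂.ne', if_neg h₂.ne']
    refine strictMono_coe_mul (one_div_pos.2 h₂) (strictMonoOn_elog ?_ ?_ ?_)
    · exact add_nonneg h₁ (mul_nonneg h₂.le hx)
    · exact add_nonneg h₁ (mul_nonneg h₂.le hy)
    · gcongr

theorem isFDPGenerator_bridgeV {l₁ l₂ : ℝ} (h₁ : 0 ≤ l₁) (h₂ : 0 ≤ l₂) (h₁₂ : 0 < l₁ + l₂) :
    IsFDPGenerator (bridgeV l₁ l₂) := by
  have hpos (t : ℝ) : 0 < l₁ + l₂ * Real.exp t := add_mul_pos h₁ h₂ h₁₂ (Real.exp_pos t)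
  have hderiv (t : ℝ) : HasDerivAt (fun t => (bridgeV l₁ l₂ (Real.exp t)).toReal)
      (1 / (l₁ + l₂ * Real.exp t) * Real.exp t) t :=
    (hasDerivAt_toReal_bridgeV (hpos t)).comp t (Real.hasDerivAt_exp t)
  refine isFDPGenerator_iff.2 ⟨strictMonoOn_bridgeV h₁ h₂ h₁₂,
    Monotone.convexOn_univ_of_deriv (fun t => (hderiv t).differentiableAt) fun s t hst => ?_⟩
  rw [(hderiv s).deriv, (hderiv t).deriv, one_div_mul_eq_div, one_div_mul_eq_div,
    div_le_div_iff₀ (hpos s) (hpos t)]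
  linarith [mul_le_mul_of_nonneg_left (Real.exp_le_exp.2 hst) h₁]

theorem fdpCE_bridgeV {l₁ l₂ : ℝ} (h₁₂ : 0 < l₁ + l₂) (γ : ℝ)
    (q p : EuclideanSpace ℝ (Fin n) → ℝ) :
    fdpCE (bridgeV l₁ l₂) γ q p = bdpCE l₁ l₂ γ q p := by
  rw [fdpCE, bdpCE]
  split_ifs with hγ h0
  · rw [(hasDerivAt_toReal_bridgeV (by rwa [mul_one])).deriv, mul_one]
  · simp only [bridgeV, if_pos h0, dpCE]
    norm_cast
    ring
  · simp only [bridgeV, if_neg h0, ← mul_assoc, ← EReal.coe_mul, div_mul_div_comm, mul_one,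
      mul_comm γ l₂]

theorem bdpClass_subset_fdpClass : bdpClass n Γ ⊆ fdpClass n Γ := by
  rintro d ⟨γ, hγΓ, l₁, l₂, h₁, h₂, h₁₂, hd⟩
  refine ⟨γ, hγΓ, bridgeV l₁ l₂, isFDPGenerator_bridgeV h₁ h₂ h₁₂, fun _ => ?_, ?_⟩
  · exact (hasDerivAt_toReal_bridgeV (by rwa [mul_one])).differentiableAt
  · simpa only [fdpCE_bridgeV h₁₂] using hd

theorem IsBridgeGenerator.exists_eq_bridgeV {v : ℝ → EReal} (hv : IsBridgeGenerator v) :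
    ∃ l₁ l₂ a b : ℝ, 0 ≤ l₁ ∧ 0 ≤ l₂ ∧ 0 < l₁ + l₂ ∧ 0 < a ∧
      ∀ z, 0 ≤ z → v z = a * bridgeV l₁ l₂ z + b := by
  rcases hv with ⟨a, b, ha, hab⟩ | ⟨a, b, l₁, l₂, ha, h₁, h₂, hab⟩
  · refine ⟨1, 0, a, b, zero_le_one, le_rfl, by norm_num, ha, fun z hz => ?_⟩
    rw [hab z hz, bridgeV, if_pos rfl, div_one, EReal.coe_add, EReal.coe_mul]
  · refine ⟨l₁, l₂, a * l₂, b, h₁, h₂.le, by positivity, by positivity, fun z hz => ?_⟩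
    rw [hab z hz, bridgeV, if_neg h₂.ne', ← mul_assoc, ← EReal.coe_mul, mul_assoc,
      mul_one_div_cancel h₂.ne', mul_one]

theorem IsBridgeGenerator.fdpCE_mem_bdpClass {v : ℝ → EReal} (hv : IsBridgeGenerator v) {γ : ℝ}
    (hγΓ : γ ∈ Γ) (hγ : 0 < γ) : (fun q p => fdpCE v γ q.1 p.1) ∈ bdpClass n Γ := by
  obtain ⟨l₁, l₂, a, b, h₁, h₂, h₁₂, ha, hab⟩ := hv.exists_eq_bridgeV
  refine ⟨γ, hγΓ, l₁, l₂, h₁, h₂, h₁₂, equivalent_of_strictMono (strictMono_coe_mul ha) ?_⟩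
  intro q p
  rw [← fdpCE_bridgeV h₁₂, fdpCE_eq v hγ.ne', fdpCE_eq _ hγ.ne']
  exact fdpVal_eq_coe_mul (isFDPGenerator_bridgeV h₁ h₂ h₁₂) ha.le hab hγ (cross_nonneg γ q p)
    (power_pos hγΓ hγ p)

end Bridge

section BridgeNormBased

variable {n : ℕ} {Γ : Set ℝ}

theorem isNBGenerator_const {f : ℝ → ℝ} (hm : StrictMonoOn f (Ici 0)) (hc : ConvexOn ℝ (Ici 0) f)
    (hd : ∀ z, 0 < z → DifferentiableAt ℝ f z) : IsNBGenerator fun _ => f :=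
  ⟨fun _ _ => hm, fun _ _ => hc, fun _ _ => hd, differentiableWithinAt_const _⟩

theorem isNBGenerator_rpow {r : ℝ} (hr : 1 < r) : IsNBGenerator fun _ z => z ^ r :=
  isNBGenerator_const (Real.strictMonoOn_rpow_Ici_of_exponent_pos (one_pos.trans hr))
    (convexOn_rpow hr.le) fun _ hz => Real.differentiableAt_rpow_const_of_ne r hz.ne'

/-- The generator, independent of the exponent, for which the norm-based Bregman cross-entropy with
exponent `r - 1` is equivalent to the bridge cross-entropy with parameters `l₁` and `l₂ > 0`. -/
def bridgeGen (l₁ l₂ r z : ℝ) : ℝ := (l₁ + l₂ * z ^ r) ^ (1 / r)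

theorem hasDerivAt_bridgeGen {l₁ l₂ r z : ℝ} (hr : r ≠ 0) (hz : 0 < z)
    (hL : 0 < l₁ + l₂ * z ^ r) : HasDerivAt (bridgeGen l₁ l₂ r)
      (l₂ * z ^ (r - 1) * (l₁ + l₂ * z ^ r) ^ (1 / r - 1)) z := by
  refine ((((Real.hasDerivAt_rpow_const (p := r) (.inl hz.ne')).const_mul l₂).const_add
    l₁).rpow_const (p := 1 / r) (.inl hL.ne')).congr_deriv ?_
  field_simp

theorem deriv_bridgeGen {l₁ l₂ r z : ℝ} (hr : r ≠ 0) (hz : 0 < z) (hL : 0 < l₁ + l₂ * z ^ r) :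
    deriv (bridgeGen l₁ l₂ r) z = l₂ * (z ^ r / (l₁ + l₂ * z ^ r)) ^ (1 - 1 / r) := by
  have hexp : r * (1 - 1 / r) = r - 1 := by field_simp
  rw [(hasDerivAt_bridgeGen hr hz hL).deriv, Real.div_rpow (by positivity) hL.le,
    ← Real.rpow_mul hz.le, hexp, mul_assoc, ← neg_sub 1 (1 / r), Real.rpow_neg hL.le,
    ← div_eq_mul_inv]

theorem strictMonoOn_bridgeGen {l₁ l₂ r : ℝ} (h₁ : 0 ≤ l₁) (h₂ : 0 < l₂) (hr : 0 < r) :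
    StrictMonoOn (bridgeGen l₁ l₂ r) (Ici 0) := fun x hx y _ hxy => by
  have hx : 0 ≤ x := hx
  unfold bridgeGen
  gcongr

theorem continuous_bridgeGen (l₁ l₂ : ℝ) {r : ℝ} (hr : 0 < r) : Continuous (bridgeGen l₁ l₂ r) :=
  (continuous_const.add (continuous_const.mul (Real.continuous_rpow_const hr.le))).rpow_const
    fun _ => .inr (one_div_pos.2 hr).le

theorem convexOn_bridgeGen {l₁ l₂ r : ℝ} (h₁ : 0 ≤ l₁) (h₂ : 0 < l₂) (hr : 1 < r) :
    ConvexOn ℝ (Ici 0) (bridgeGen l₁ l₂ r) := by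
  have hr0 : 0 < r := one_pos.trans hr
  have hL {z : ℝ} (hz : 0 < z) : 0 < l₁ + l₂ * z ^ r := by positivity
  refine MonotoneOn.convexOn_of_deriv (convex_Ici 0)
    (continuous_bridgeGen l₁ l₂ hr0).continuousOn ?_ ?_ <;> rw [interior_Ici]
  · exact fun z hz => (hasDerivAt_bridgeGen hr0.ne' hz (hL hz)).differentiableAt
      |>.differentiableWithinAt
  intro x hx y hy hxy
  have hx : 0 < x := hx
  have hy : 0 < y := hy
  have hfrac : x ^ r / (l₁ + l₂ * x ^ r) ≤ y ^ r / (l₁ + l₂ * y ^ r) := by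
    rw [div_le_div_iff₀ (hL hx) (hL hy)]
    linarith [mul_le_mul_of_nonneg_left (Real.rpow_le_rpow hx.le hxy hr0.le) h₁]
  have hexp : 0 ≤ 1 - 1 / r := sub_nonneg.2 ((div_le_one hr0).2 hr.le)
  rw [deriv_bridgeGen hr0.ne' hx (hL hx), deriv_bridgeGen hr0.ne' hy (hL hy)]
  gcongr

theorem isNBGenerator_bridgeGen {l₁ l₂ r : ℝ} (h₁ : 0 ≤ l₁) (h₂ : 0 < l₂) (hr : 1 < r) :
    IsNBGenerator fun _ => bridgeGen l₁ l₂ r :=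
  have hr0 : 0 < r := one_pos.trans hr
  isNBGenerator_const (strictMonoOn_bridgeGen h₁ h₂ hr0) (convexOn_bridgeGen h₁ h₂ hr)
    fun _ hz => (hasDerivAt_bridgeGen hr0.ne' hz (by positivity)).differentiableAt

theorem powerNorm_rpow {γ : ℝ} (hγ : 0 < γ) {p : EuclideanSpace ℝ (Fin n) → ℝ}
    (hp : 0 < power γ p) : powerNorm γ p ^ (1 + γ) = power γ p := by
  rw [powerNorm, ← Real.rpow_mul hp.le, one_div_mul_cancel (by positivity), Real.rpow_one]

theorem nbCE_rpow_eq {γ : ℝ} (hγ : 0 < γ) {q p : EuclideanSpace ℝ (Fin n) → ℝ}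
    (hp : 0 < power γ p) : nbCE (fun _ z => z ^ (1 + γ)) γ q p = ((dpCE γ q p : ℝ) : EReal) := by
  have hN : 0 < powerNorm γ p := Real.rpow_pos_of_pos hp _
  rw [nbCE, if_neg hγ.ne', Real.deriv_rpow_const, powerNorm_rpow hγ hp, add_sub_cancel_left,
    Real.one_rpow, dpCE]
  congr 1
  field_simp
  ring

/-- The norm-based Bregman cross-entropy of `bridgeGen l₁ l₂ (1 + γ)` is a decreasing affine
function of this quantity, and the bridge cross-entropy one of its logarithm. -/
def bridgeFactor (l₁ l₂ γ : ℝ) (q p : EuclideanSpace ℝ (Fin n) → ℝ) : ℝ :=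
  (l₁ + l₂ * power γ p) ^ (1 / (1 + γ) - 1) * (l₁ + l₂ * cross γ q p)

theorem nbCE_bridgeGen_eq {γ l₁ l₂ : ℝ} (hγ : 0 < γ) (h₁ : 0 ≤ l₁) (h₂ : 0 < l₂)
    {q p : EuclideanSpace ℝ (Fin n) → ℝ} (hp : 0 < power γ p) :
    nbCE (fun _ => bridgeGen l₁ l₂ (1 + γ)) γ q p =
      ((-(1 / γ * bridgeFactor l₁ l₂ γ q p) + bridgeGen l₁ l₂ (1 + γ) 1 / γ : ℝ) : EReal) := by
  have hN : 0 < powerNorm γ p := Real.rpow_pos_of_pos hp _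
  have hNγ := powerNorm_rpow hγ hp
  have hL : 0 < l₁ + l₂ * power γ p := by positivity
  have hval : bridgeGen l₁ l₂ (1 + γ) (powerNorm γ p) =
      (l₁ + l₂ * power γ p) ^ (1 / (1 + γ) - 1) * (l₁ + l₂ * power γ p) := by
    rw [bridgeGen, hNγ, Real.rpow_sub_one hL.ne', div_mul_cancel₀ _ hL.ne']
  rw [nbCE, if_neg hγ.ne', (hasDerivAt_bridgeGen (by positivity) hN (by rwa [hNγ])).deriv, hNγ,
    hval, add_sub_cancel_left, bridgeFactor]
  congr 1
  field_simp
  ring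

theorem bdpCE_eq_elog_bridgeFactor {γ l₁ l₂ : ℝ} (hγ : 0 < γ) (h₁ : 0 ≤ l₁) (h₂ : 0 < l₂)
    {q p : EuclideanSpace ℝ (Fin n) → ℝ} (hp : 0 < power γ p) :
    bdpCE l₁ l₂ γ q p = -((((1 + γ) / (l₂ * γ) : ℝ) : EReal) * elog (bridgeFactor l₁ l₂ γ q p)) +
      ((1 / (l₂ * γ) * Real.log (l₁ + l₂) : ℝ) : EReal) := by
  have hL : 0 < l₁ + l₂ * power γ p := by positivity
  have hL₁ : 0 < l₁ + l₂ := by positivity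
  have hLr : 0 < (l₁ + l₂ * power γ p) ^ (1 / (1 + γ) - 1) := by positivity
  rw [bdpCE, if_neg hγ.ne', if_neg h₂.ne', bridgeFactor, elog_mul hLr.le, elog_of_pos hLr,
    elog_of_pos hL, elog_of_pos hL₁, Real.log_rpow hL, add_comm (Real.toEReal _) (elog _),
    neg_coe_mul_add (by positivity), add_assoc, add_assoc]
  congr 1
  norm_cast
  field_simp
  ring

theorem equivalent_nbCE_bdpCE_of_pos {γ l₁ l₂ : ℝ} (hγΓ : γ ∈ Γ) (hγ : 0 < γ) (h₁ : 0 ≤ l₁)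
    (h₂ : 0 < l₂) : Equivalent (n := n) (Γ := Γ)
      (fun q p => nbCE (fun _ => bridgeGen l₁ l₂ (1 + γ)) γ q.1 p.1)
      (fun q p => bdpCE l₁ l₂ γ q.1 p.1) := by
  have hfactor (q p : densities n Γ) : bridgeFactor l₁ l₂ γ q.1 p.1 ∈ Ici 0 :=
    mul_nonneg
      (Real.rpow_nonneg (add_nonneg h₁ (mul_nonneg h₂.le (power_pos hγΓ hγ p).le)) _)
      (add_nonneg h₁ (mul_nonneg h₂.le (cross_nonneg γ q p)))
  have hnb : StrictAnti fun x : ℝ => -(1 / γ * x) + bridgeGen l₁ l₂ (1 + γ) 1 / γ :=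
    fun x y hxy => by
      beta_reduce
      gcongr
  have hbdp := (strictAnti_neg_coe_mul_add_coe (a := (1 + γ) / (l₂ * γ)) (by positivity)
    (1 / (l₂ * γ) * Real.log (l₁ + l₂))).comp_strictMonoOn strictMonoOn_elog
  refine equivalent_of_lt_iff_lt fun q p q' p' => ?_
  rw [nbCE_bridgeGen_eq hγ h₁ h₂ (power_pos hγΓ hγ p),
    nbCE_bridgeGen_eq hγ h₁ h₂ (power_pos hγΓ hγ p'), EReal.coe_lt_coe_iff, hnb.lt_iff_gt,
    bdpCE_eq_elog_bridgeFactor hγ h₁ h₂ (power_pos hγΓ hγ p),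
    bdpCE_eq_elog_bridgeFactor hγ h₁ h₂ (power_pos hγΓ hγ p')]
  exact (hbdp.lt_iff_gt (hfactor q p) (hfactor q' p')).symm

theorem equivalent_nbCE_bdpCE_zero {γ l₁ : ℝ} (hγΓ : γ ∈ Γ) (hγ : 0 < γ) (h₁ : 0 < l₁) :
    Equivalent (n := n) (Γ := Γ) (fun q p => nbCE (fun _ z => z ^ (1 + γ)) γ q.1 p.1)
      (fun q p => bdpCE l₁ 0 γ q.1 p.1) :=
  equivalent_of_strictMono (strictMono_coe_mul (one_div_pos.2 h₁)) fun q p => by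
    rw [nbCE_rpow_eq hγ (power_pos hγΓ hγ p), bdpCE, if_neg hγ.ne', if_pos rfl, EReal.coe_mul]

theorem equivalent_shannon_bdpCE {l₁ l₂ : ℝ} (h₁₂ : 0 < l₁ + l₂) :
    Equivalent (n := n) (Γ := Γ) (fun q p => shannon q.1 p.1)
      (fun q p => bdpCE l₁ l₂ 0 q.1 p.1) :=
  equivalent_of_strictMono (strictMono_coe_mul (one_div_pos.2 h₁₂)) fun q p => by
    rw [bdpCE, if_pos rfl]

theorem bdpClass_subset_nbClass (hΓ : ∀ γ ∈ Γ, 0 ≤ γ) : bdpClass n Γ ⊆ nbClass n Γ := by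
  rintro d ⟨γ, hγΓ, l₁, l₂, h₁, h₂, h₁₂, hd⟩
  rcases (hΓ γ hγΓ).eq_or_lt with rfl | hγ
  · have hφ := isNBGenerator_rpow one_lt_two
    exact ⟨0, hγΓ, _, hφ,
      (hφ.equivalent_shannon_nbCE.symm.trans (equivalent_shannon_bdpCE h₁₂)).trans hd⟩
  · have hr : 1 < 1 + γ := lt_add_of_pos_right 1 hγ
    rcases h₂.eq_or_lt with rfl | h₂
    · rw [add_zero] at h₁₂
      exact ⟨γ, hγΓ, _, isNBGenerator_rpow hr, (equivalent_nbCE_bdpCE_zero hγΓ hγ h₁₂).trans hd⟩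
    · exact ⟨γ, hγΓ, _, isNBGenerator_bridgeGen h₁ h₂ hr,
        (equivalent_nbCE_bdpCE_of_pos hγΓ hγ h₁ h₂).trans hd⟩

end BridgeNormBased

/-! ### The intersection of the classes -/

section Intersection

variable {n : ℕ} [NeZero n] {Γ : Set ℝ} {φ : ℝ → ℝ → ℝ} {v : ℝ → EReal}

theorem exponent_eq_of_equivalent (hΓ : ∀ γ ∈ Γ, 0 ≤ γ) {γ γ' : ℝ} (hγΓ : γ ∈ Γ) (hγ'Γ : γ' ∈ Γ)
    (hφ : IsNBGenerator φ) (hv : IsFDPGenerator v)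
    (h : Equivalent (n := n) (Γ := Γ) (fun q p => nbCE φ γ q.1 p.1)
      (fun q p => fdpCE v γ' q.1 p.1)) : γ = γ' := by
  by_contra hne
  rcases (hΓ γ' hγ'Γ).eq_or_lt with rfl | hγ'
  · have hγ : 0 < γ := (hΓ γ hγΓ).lt_of_ne' hne
    obtain ⟨q, q', p, hterm, hcross⟩ :=
      exists_crossTerm_eq_cross_ne (n := n) hΓ le_rfl hγ (Ne.symm hne)
    exact hcross (hφ.cross_eq_of_nbCE_eq hγ (power_pos hγΓ hγ p)
      ((h.eq_iff_eq q p q' p).2 (fdpCE_congr hterm)))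
  · obtain ⟨q, q', p, hterm, hcross⟩ :=
      exists_crossTerm_eq_cross_ne (n := n) hΓ (hΓ γ hγΓ) hγ' hne
    have heq := (h.eq_iff_eq q p q' p).1 (nbCE_congr hterm)
    rw [fdpCE_eq v hγ'.ne', fdpCE_eq v hγ'.ne'] at heq
    exact hcross ((hv.strictAntiOn_fdpVal hγ' (power_pos hγ'Γ hγ' p)).injOn
      (cross_nonneg γ' q p) (cross_nonneg γ' q' p) heq)

theorem isBridgeGenerator_of_equivalent (hΓ : ∀ γ ∈ Γ, 0 ≤ γ) {γ : ℝ} (hγ : 0 < γ)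
    (hφ : IsNBGenerator φ) (hv : IsFDPGenerator v)
    (h : Equivalent (n := n) (Γ := Γ) (fun q p => nbCE φ γ q.1 p.1)
      (fun q p => fdpCE v γ q.1 p.1)) : IsBridgeGenerator v := by
  have hordered : OrderedByAffine v γ (nbSlope φ γ) (nbIntercept φ γ) := by
    intro x x' y y' hx hx' hy hy'
    obtain ⟨q, p, rfl, rfl⟩ := exists_cross_eq_power_eq (n := n) hΓ hγ hx hy
    obtain ⟨q', p', rfl, rfl⟩ := exists_cross_eq_power_eq (n := n) hΓ hγ hx' hy'
    rw [← fdpCE_eq v hγ.ne', ← fdpCE_eq v hγ.ne', ← h.lt_iff_lt, nbCE_eq φ hγ.ne',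
      nbCE_eq φ hγ.ne', EReal.coe_lt_coe_iff, neg_lt_neg_iff]
  exact hordered.isBridgeGenerator hv hγ fun y hy => hφ.nbSlope_pos hγ hy

theorem nbClass_inter_fdpClass_subset (hΓ : ∀ γ ∈ Γ, 0 ≤ γ) :
    nbClass n Γ ∩ fdpClass n Γ ⊆ bdpClass n Γ := by
  rintro d ⟨⟨γ, hγΓ, φ, hφ, hnb⟩, γ', hγ'Γ, v, hv, -, hfdp⟩
  have h := hnb.trans hfdp.symm
  obtain rfl := exponent_eq_of_equivalent hΓ hγΓ hγ'Γ hφ hv h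
  rcases (hΓ γ hγΓ).eq_or_lt with rfl | hγ
  · exact ⟨0, hγΓ, 1, 0, zero_le_one, le_rfl, by norm_num,
      ((equivalent_shannon_bdpCE (by norm_num)).symm.trans hφ.equivalent_shannon_nbCE).trans hnb⟩
  · obtain ⟨γ', hγ'Γ, l₁, l₂, h₁, h₂, h₁₂, hbdp⟩ :=
      (isBridgeGenerator_of_equivalent hΓ hγ hφ hv h).fdpCE_mem_bdpClass (n := n) hγΓ hγ
    exact ⟨γ', hγ'Γ, l₁, l₂, h₁, h₂, h₁₂, hbdp.trans hfdp⟩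

theorem fdpCE_mem_nbClass_iff (hΓ : ∀ γ ∈ Γ, 0 ≤ γ) {γ : ℝ} (hγΓ : γ ∈ Γ) (hγ : 0 < γ)
    (hv : IsFDPGenerator v) :
    (fun q p => fdpCE v γ q.1 p.1) ∈ nbClass n Γ ↔ IsBridgeGenerator v := by
  constructor
  · rintro ⟨γ', hγ'Γ, φ, hφ, h⟩
    obtain rfl := exponent_eq_of_equivalent hΓ hγ'Γ hγΓ hφ hv h
    exact isBridgeGenerator_of_equivalent hΓ hγ hφ hv h
  · exact fun hbridge => bdpClass_subset_nbClass hΓ (hbridge.fdpCE_mem_bdpClass hγΓ hγ)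

end Intersection

end PowerDivergence

end

theorem theorem2 (n : ℕ) (hn : 0 < n) (Γ : Set ℝ) (hΓ : ∀ γ ∈ Γ, 0 ≤ γ)
    (hpos : ∃ γ ∈ Γ, 0 < γ) :
    PowerDivergence.nbClass n Γ ∩ PowerDivergence.fdpClass n Γ = PowerDivergence.bdpClass n Γ ∧
    ∀ γ ∈ Γ, 0 < γ → ∀ v : ℝ → EReal, PowerDivergence.IsFDPGenerator v →
      ((fun q p => PowerDivergence.fdpCE v γ q.1 p.1) ∈ PowerDivergence.nbClass n Γ ↔
        (∃ a b : ℝ, 0 < a ∧ ∀ z : ℝ, 0 ≤ z → v z = ((a * z + b : ℝ) : EReal)) ∨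
        ∃ a b l₁ l₂ : ℝ, 0 < a ∧ 0 ≤ l₁ ∧ 0 < l₂ ∧
          ∀ z : ℝ, 0 ≤ z →
            v z = (a : EReal) * PowerDivergence.elog (l₁ + l₂ * z) + (b : EReal)) := by
  have : NeZero n := ⟨hn.ne'⟩
  open PowerDivergence in
  exact ⟨Subset.antisymm (nbClass_inter_fdpClass_subset hΓ)
      (subset_inter (bdpClass_subset_nbClass hΓ) bdpClass_subset_fdpClass),
    fun γ hγΓ hγ v hv => fdpCE_mem_nbClass_iff hΓ hγΓ hγ hv⟩
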